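/- Let $G(8,4)$ be the graph with vertex set $\{v_0,\dots,v_7\}$ and edge set $\{v_iv_j : j\equiv i+1 \text{ or } j\equiv i+4 \pmod 8\}$. For disjoint graphs $G_0,G_1$ of the same order and a bijection $\phi:V(G_0)\to V(G_1)$, let $G_0\oplus_\phi G_1$ be the graph with vertex set $V(G_0)\cup V(G_1)$ and edge set $E(G_0)\cup E(G_1)\cup\{v\phi(v): v\in V(G_0)\}$. The $3$-dimensional restricted hypercube-like graph (restricted HL-graph) is $G(8,4)$, and for $m\ge 4$ the $m$-dimensional restricted HL-graphs are the graphs $G_0\oplus_\phi G_1$, where $G_0,G_1$ are $(m-1)$-dimensional restricted HL-graphs and $\phi:V(G_0)\to V(G_1)$ is any bijection (graphs being considered up to isomorphism). A fractional perfect matching of a graph $G$ is a function $f:E(G)\to[0,1]$ such that $\sum_{e\ni v}f(e)=1$ for every vertex $v$ of $G$. For a finite graph $G$, let $\mathrm{fsmp}(G)$ denote the minimum size $|F|$ of a set $F\subseteq V(G)\cup E(G)$ of vertices and edges such that $G-F$ has no fractional perfect matching. Then $\mathrm{fsmp}(G)=5$ for every $5$-dimensional restricted HL-graph $G$. (In particular,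 deleting any $4$ vertices and/or edges from $G$ leaves a graph with a fractional perfect matching.) -/

import Mathlib

universe u

/-- The recursive circulant `G(8,4)`: vertices `v_i` for `i` modulo `8`, and an edge `v_i v_j`
whenever `j ≡ i + 1` or `j ≡ i + 4` modulo `8`. -/
def recursiveCirculant84 : SimpleGraph (ZMod 8) :=
  SimpleGraph.fromRel fun i j => j = i + 1 ∨ j = i + 4

/-- The graph `G₀ ⊕_φ G₁`: the disjoint union of `G₀` and `G₁` together with the cross edges
`v φ(v)` for all vertices `v` of `G₀`. -/
def matchingJoin {V₀ V₁ : Type u} (G₀ : SimpleGraph V₀) (G₁ : SimpleGraph V₁) (φ : V₀ ≃ V₁) :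
    SimpleGraph (V₀ ⊕ V₁) where
  Adj
    | Sum.inl a, Sum.inl b => G₀.Adj a b
    | Sum.inr a, Sum.inr b => G₁.Adj a b
    | Sum.inl a, Sum.inr b => φ a = b
    | Sum.inr a, Sum.inl b => φ b = a
  symm := ⟨by
    rintro (a | a) (b | b) h
    · exact SimpleGraph.Adj.symm h
    · exact h
    · exact h
    · exact SimpleGraph.Adj.symm h⟩
  loopless := ⟨by
    rintro (a | a) h
    · exact SimpleGraph.irrefl _ h
    · exact SimpleGraph.irrefl _ h⟩

/-- `IsRestrictedHL m G`: the graph `G` is (up to isomorphism) an `m`-dimensional restricted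
hypercube-like graph. In dimension `3` the only one is `G(8,4)`; the `(m+1)`-dimensional ones are
the graphs `G₀ ⊕_φ G₁` with `G₀`, `G₁` of dimension `m` and `φ` any bijection of their
vertex sets. -/
inductive IsRestrictedHL : ℕ → ∀ {V : Type u}, SimpleGraph V → Prop
  | base {V : Type u} {G : SimpleGraph V} (e : G ≃g recursiveCirculant84) :
      IsRestrictedHL 3 G
  | step {m : ℕ} {V₀ V₁ V : Type u} {G₀ : SimpleGraph V₀} {G₁ : SimpleGraph V₁}
      {G : SimpleGraph V} (h₀ : IsRestrictedHL m G₀) (h₁ : IsRestrictedHL m G₁)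
      (φ : V₀ ≃ V₁) (e : G ≃g matchingJoin G₀ G₁ φ) : IsRestrictedHL (m + 1) G

open Classical in
/-- `f` assigns to each edge of `G` a number in `[0,1]` such that the values on the edges incident
to any given vertex add up to exactly `1`. -/
def IsFractionalPerfectMatching {V : Type u} [Fintype V] (G : SimpleGraph V)
    (f : G.edgeSet → ℝ) : Prop :=
  (∀ e, 0 ≤ f e ∧ f e ≤ 1) ∧
    ∀ v : V, ∑ e : G.edgeSet with v ∈ e.val, f e = 1

/-- The graph `G - F`, where `F` consists of the vertices in `FV` and the edges in `FE`. -/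
def deleteFaults {V : Type u} (G : SimpleGraph V) (FV : Finset V) (FE : Finset (Sym2 V)) :
    SimpleGraph {v : V // v ∉ FV} :=
  (G.deleteEdges (FE : Set (Sym2 V))).comap Subtype.val

open Classical in
/-- `F = FV ∪ FE ⊆ V(G) ∪ E(G)` is a fractional strong matching preclusion set: `G - F` has no
fractional perfect matching. -/
def IsFSMPSet {V : Type u} [Fintype V] (G : SimpleGraph V)
    (FV : Finset V) (FE : Finset (Sym2 V)) : Prop :=
  (FE : Set (Sym2 V)) ⊆ G.edgeSet ∧
    ¬ ∃ f : (deleteFaults G FV FE).edgeSet → ℝ,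
        IsFractionalPerfectMatching (deleteFaults G FV FE) f

/-- The fractional strong matching preclusion number of `G`: the minimum size of an FSMP set.
(If there is no FSMP set at all, the value is `0` by convention.) -/
noncomputable def fsmp {V : Type u} [Fintype V] (G : SimpleGraph V) : ℕ :=
  sInf {k | ∃ (FV : Finset V) (FE : Finset (Sym2 V)),
    IsFSMPSet G FV FE ∧ FV.card + FE.card = k}

/-! The vertices and edges removed from `G` are treated together by an expansion property: `G`
*expands by `k`* when every nonempty vertex set `S` satisfies `|S| + k ≤ |T| + |D|` as soon as
`T` is a vertex set disjoint from `S` and `D` a set of edges such that each edge at `S` ends in `T`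
or lies in `D`.

If `G` expands by `k`, then removing at most `k` vertices and edges leaves Hall's condition
`|S| ≤ |N(S)|` intact (`Expands.card_le_card_neighbors`). Hall's theorem then gives a permutation
moving each vertex to a neighbour, and putting weight `1/2` on `{v, σ v}` for every `v` is a
fractional perfect matching (`exists_isFractionalPerfectMatching_of_injective`).

So it suffices that a `5`-dimensional restricted HL-graph expands by `4`. The graph `G(8,4)` expands
by `1` (`expands_recursiveCirculant84`). In `G₀ ⊕_φ G₁`, with `G₀`, `G₁` expanding by `k` and
`δ`-regular, a set `S` meeting both sides gains `2k`. A set inside one side gains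
`|S|` from its matching edges in addition to `k`, and a single vertex gains `δ`. Hence the join
expands by `min (2k) (min (k + 2) δ)` (`Expands.matchingJoin`), which leads from `1` to `2` to `4`,
and to `min (2 ^ (m - 3)) (m - 1)` in dimension `m`.

Conversely, restricted HL-graphs of dimension `m` are `m`-regular, and removing all edges at a
vertex isolates it.
-/

/-! ### Expansion and its behaviour under isomorphism -/

/-- `G` expands by `k`: if all edges at a nonempty set `S` of vertices are blocked, each by having
its other end in `T` or by belonging to `D`, where `T` is disjoint from `S`, then
`|T| + |D| ≥ |S| + k`. Neither `G` nor its vertex type need be finite, and `D` may contain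
pairs that are not edges of `G`. -/
def Expands {V : Type*} (G : SimpleGraph V) (k : ℕ) : Prop :=
  ∀ (S T : Finset V) (D : Finset (Sym2 V)), S.Nonempty → Disjoint S T →
    (∀ x ∈ S, ∀ y, G.Adj x y → y ∈ T ∨ s(x, y) ∈ D) → S.card + k ≤ T.card + D.card

/-- Every vertex of `G` has exactly `d` neighbours. Unlike `SimpleGraph.IsRegularOfDegree`, this
needs no local finiteness instance. -/
def HasDegree {V : Type*} (G : SimpleGraph V) (d : ℕ) : Prop :=
  ∀ v, ∃ N : Finset V, N.card = d ∧ ∀ y, y ∈ N ↔ G.Adj v y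

theorem Finset.card_le_card_add_card_of_injOn {α β γ : Type*} {S : Finset α} {T : Finset β}
    {D : Finset γ} {f : α → β} {g : α → γ} (hf : Set.InjOn f S) (hg : Set.InjOn g S)
    (h : ∀ x ∈ S, f x ∈ T ∨ g x ∈ D) : S.card ≤ T.card + D.card := by
  classical
  rw [← Finset.card_filter_add_card_filter_not (s := S) (fun x => f x ∈ T)]
  refine add_le_add (Finset.card_le_card_of_injOn f ?_ ?_) (Finset.card_le_card_of_injOn g ?_ ?_)
  · intro x hx
    exact (Finset.mem_filter.1 hx).2
  · exact hf.mono fun x hx => (Finset.mem_filter.1 hx).1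
  · intro x hx
    obtain ⟨hx, hx'⟩ := Finset.mem_filter.1 hx
    exact (h x hx).resolve_left hx'
  · exact hg.mono fun x hx => (Finset.mem_filter.1 hx).1

theorem Expands.mono {V : Type*} {G : SimpleGraph V} {k l : ℕ} (h : Expands G k) (hl : l ≤ k) :
    Expands G l := fun S T D hS hST hD => by
  have := h S T D hS hST hD
  omega

theorem Expands.of_iso {V W : Type*} {G : SimpleGraph V} {H : SimpleGraph W} {k : ℕ}
    (h : Expands H k) (e : G ≃g H) : Expands G k := by
  intro S T D hS hST hD
  have := h (S.map e.toEquiv.toEmbedding) (T.map e.toEquiv.toEmbedding)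
    (D.map e.toEquiv.toEmbedding.sym2Map) (by simpa using hS) (by simpa using hST) ?_
  · simpa using this
  · intro x hx y hxy
    obtain ⟨x, hxS, rfl⟩ := Finset.mem_map.1 hx
    obtain ⟨y, rfl⟩ := e.surjective y
    rcases hD x hxS y (e.map_rel_iff.1 hxy) with h | h
    · exact Or.inl (Finset.mem_map_of_mem _ h)
    · exact Or.inr (Finset.mem_map_of_mem e.toEquiv.toEmbedding.sym2Map h)

theorem HasDegree.of_iso {V W : Type*} {G : SimpleGraph V} {H : SimpleGraph W} {d : ℕ}
    (h : HasDegree H d) (e : G ≃g H) : HasDegree G d := by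
  intro v
  obtain ⟨N, hN, hN'⟩ := h (e v)
  refine ⟨N.map e.symm.toEquiv.toEmbedding, by simpa using hN, fun y => ?_⟩
  rw [← e.map_rel_iff, ← hN']
  constructor
  · intro hy
    obtain ⟨z, hz, rfl⟩ := Finset.mem_map.1 hy
    simpa using hz
  · intro hy
    exact Finset.mem_map.2 ⟨e y, hy, by simp⟩

theorem HasDegree.le_card_add_card {V : Type*} {G : SimpleGraph V} {d : ℕ} (h : HasDegree G d)
    {x : V} {T : Finset V} {D : Finset (Sym2 V)}
    (hD : ∀ y, G.Adj x y → y ∈ T ∨ s(x, y) ∈ D) : d ≤ T.card + D.card := by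
  obtain ⟨N, rfl, hN⟩ := h x
  exact Finset.card_le_card_add_card_of_injOn (f := id) (g := fun y => s(x, y))
    (Set.injOn_id _) (fun y _ z _ hyz => Sym2.congr_right.1 hyz) fun y hy => hD y ((hN y).1 hy)

/-! ### The graph `G(8,4)` -/

theorem recursiveCirculant84_adj {x y : ZMod 8} :
    recursiveCirculant84.Adj x y ↔ y = x + 1 ∨ y = x - 1 ∨ y = x + 4 := by
  rw [recursiveCirculant84, SimpleGraph.fromRel_adj]
  revert x y
  decide

theorem hasDegree_recursiveCirculant84 : HasDegree recursiveCirculant84 3 := by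
  intro v
  refine ⟨{v + 1, v - 1, v + 4}, ?_, fun y => ?_⟩
  · revert v
    decide
  · rw [recursiveCirculant84_adj]
    simp

/-- The shift `x ↦ x + 1` sends the elements of `S` injectively to blocking vertices or edges, so
`|S| ≤ |T| + |D|`. In case of equality this exhausts `D`, so no chord `{x, x + 4}` lies in `D`;
then `S + 4 ⊆ T`, which forces `D = ∅` and `S + 1 = T = S + 4`. Thus `S` is invariant under the
shift by `5`, hence equal to the whole of `ZMod 8`, and meets `T`. -/
theorem expands_recursiveCirculant84 : Expands recursiveCirculant84 1 := by
  intro S T D hS hST hD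
  have inj_add (c : ZMod 8) : Set.InjOn (fun x => x + c) (S : Set (ZMod 8)) :=
    (add_left_injective c).injOn
  have inj_edge : Set.InjOn (fun x : ZMod 8 => s(x, x + 1)) (S : Set (ZMod 8)) := by
    have : ∀ x y : ZMod 8, s(x, x + 1) = s(y, y + 1) → x = y := by decide
    exact fun x _ y _ => this x y
  have h1 : ∀ x ∈ S, x + 1 ∈ T ∨ s(x, x + 1) ∈ D := fun x hx =>
    hD x hx _ (recursiveCirculant84_adj.2 (Or.inl rfl))
  have h4 : ∀ x ∈ S, x + 4 ∈ T ∨ s(x, x + 4) ∈ D := fun x hx =>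
    hD x hx _ (recursiveCirculant84_adj.2 (Or.inr (Or.inr rfl)))
  by_contra! hlt
  have no_chord : ∀ x, s(x, x + 4) ∉ D := by
    intro x hx
    have := Finset.card_le_card_add_card_of_injOn (T := T) (D := D.erase s(x, x + 4))
      (inj_add 1) inj_edge fun y hy => (h1 y hy).imp_right fun h => Finset.mem_erase.2 ⟨?_, h⟩
    · have := Finset.card_erase_lt_of_mem hx
      omega
    · have : ∀ x y : ZMod 8, s(y, y + 1) ≠ s(x, x + 4) := by decide
      exact this x y
  have add_four : ∀ x ∈ S, x + 4 ∈ T := fun x hx => (h4 x hx).resolve_right (no_chord x)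
  have hST_card : S.card ≤ T.card := Finset.card_le_card_of_injOn _ add_four (inj_add 4)
  have hD_empty : D = ∅ := Finset.card_eq_zero.1 (by omega)
  have add_one : ∀ x ∈ S, x + 1 ∈ T := fun x hx => (h1 x hx).resolve_right (by simp [hD_empty])
  have hT : S.image (fun x => x + 4) = T :=
    Finset.eq_of_subset_of_card_le (Finset.image_subset_iff.2 add_four)
      (by rw [Finset.card_image_of_injOn (inj_add 4)]; omega)
  have add_five : ∀ x ∈ S, x + 5 ∈ S := by
    intro x hx
    obtain ⟨y, hy, hxy⟩ := Finset.mem_image.1 (hT.symm ▸ add_one x hx)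
    have : ∀ x y : ZMod 8, y + 4 = x + 1 → x + 5 = y := by decide
    rwa [this x y hxy]
  obtain ⟨x, hx⟩ := hS
  have hx' := add_five _ (add_five _ (add_five _ (add_five x hx)))
  have : ∀ x : ZMod 8, x + 5 + 5 + 5 + 5 = x + 4 := by decide
  rw [this x] at hx'
  exact Finset.disjoint_left.1 hST hx' (add_four x hx)

/-! ### Joining two graphs along a perfect matching -/

theorem HasDegree.matchingJoin {V₀ V₁ : Type u} {G₀ : SimpleGraph V₀} {G₁ : SimpleGraph V₁}
    {d : ℕ} (h₀ : HasDegree G₀ d) (h₁ : HasDegree G₁ d) (φ : V₀ ≃ V₁) :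
    HasDegree (matchingJoin G₀ G₁ φ) (d + 1) := by
  rintro (v | v)
  · obtain ⟨N, rfl, hN⟩ := h₀ v
    refine ⟨N.disjSum {φ v}, by simp, ?_⟩
    rintro (y | y)
    · simpa [_root_.matchingJoin] using hN y
    · simpa [_root_.matchingJoin] using eq_comm
  · obtain ⟨N, rfl, hN⟩ := h₁ v
    refine ⟨Finset.disjSum {φ.symm v} N, by simp [add_comm], ?_⟩
    rintro (y | y)
    · simp [_root_.matchingJoin, Equiv.eq_symm_apply]
    · simpa [_root_.matchingJoin] using hN y

open Classical in
/-- The pairs in `D` with one element on each side of a disjoint union. -/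
noncomputable def crossPairs {V₀ V₁ : Type*} (D : Finset (Sym2 (V₀ ⊕ V₁))) :
    Finset (Sym2 (V₀ ⊕ V₁)) :=
  D.filter fun e => ∃ a b, e = s(Sum.inl a, Sum.inr b)

theorem mem_crossPairs {V₀ V₁ : Type*} {D : Finset (Sym2 (V₀ ⊕ V₁))} {e : Sym2 (V₀ ⊕ V₁)} :
    e ∈ crossPairs D ↔ e ∈ D ∧ ∃ a b, e = s(Sum.inl a, Sum.inr b) := by
  simp [crossPairs]

/-- The pairs in `D` consisting of two elements of `V`, for an embedding of `V`. -/
noncomputable def innerPairs {V W : Type*} (f : V ↪ W) (D : Finset (Sym2 W)) : Finset (Sym2 V) :=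
  D.preimage f.sym2Map f.sym2Map.injective.injOn

theorem mem_innerPairs {V W : Type*} {f : V ↪ W} {D : Finset (Sym2 W)} {x y : V} :
    s(x, y) ∈ innerPairs f D ↔ s(f x, f y) ∈ D := by
  simp [innerPairs]

theorem card_innerPairs_add_card_crossPairs_le {V₀ V₁ : Type*} (D : Finset (Sym2 (V₀ ⊕ V₁))) :
    (innerPairs .inl D).card + (innerPairs .inr D).card + (crossPairs D).card ≤ D.card := by
  classical
  rw [← Finset.card_map (Function.Embedding.sym2Map .inl),
    ← Finset.card_map (s := innerPairs .inr D) (Function.Embedding.sym2Map .inr),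
    ← Finset.card_union_of_disjoint, ← Finset.card_union_of_disjoint]
  · refine Finset.card_le_card (Finset.union_subset (Finset.union_subset ?_ ?_)
      (Finset.filter_subset _ _))
    all_goals
      intro e he
      obtain ⟨e, heD, rfl⟩ := Finset.mem_map.1 he
      exact Finset.mem_preimage.1 heD
  · rw [Finset.disjoint_left]
    intro e he he'
    obtain ⟨a, b, rfl⟩ := (mem_crossPairs.1 he').2
    rcases Finset.mem_union.1 he with he | he
    all_goals
      obtain ⟨e, -, he⟩ := Finset.mem_map.1 he
      induction e with | _ x y => simp at he
  · rw [Finset.disjoint_left]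
    intro e he he'
    obtain ⟨e, -, rfl⟩ := Finset.mem_map.1 he
    obtain ⟨e', -, he⟩ := Finset.mem_map.1 he'
    induction e with | _ x y =>
    induction e' with | _ x' y' => simp at he

/-- A set meeting both sides gains `k` from each of them. A set inside one side gains `k` from that
side and one for each of its matching edges, hence at least `k + 2` unless it is a single vertex,
which gains `d`. -/
theorem Expands.matchingJoin {V₀ V₁ : Type u} {G₀ : SimpleGraph V₀} {G₁ : SimpleGraph V₁}
    {k d : ℕ} (h₀ : Expands G₀ k) (h₁ : Expands G₁ k) (hd₀ : HasDegree G₀ d)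
    (hd₁ : HasDegree G₁ d) (φ : V₀ ≃ V₁) :
    Expands (matchingJoin G₀ G₁ φ) (min (2 * k) (min (k + 2) d)) := by
  intro S T D hS hST hD
  have hcard := card_innerPairs_add_card_crossPairs_le D
  have hS_card := S.card_toLeft_add_card_toRight
  have hT_card := T.card_toLeft_add_card_toRight
  have disj₀ : Disjoint S.toLeft T.toLeft := by
    simp only [Finset.disjoint_left, Finset.mem_toLeft] at hST ⊢
    exact fun x => @hST (Sum.inl x)
  have disj₁ : Disjoint S.toRight T.toRight := by
    simp only [Finset.disjoint_left, Finset.mem_toRight] at hST ⊢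
    exact fun x => @hST (Sum.inr x)
  have block₀ : ∀ x ∈ S.toLeft, ∀ y, G₀.Adj x y →
      y ∈ T.toLeft ∨ s(x, y) ∈ innerPairs .inl D := by
    intro x hx y hxy
    rw [Finset.mem_toLeft, mem_innerPairs]
    exact hD (Sum.inl x) (Finset.mem_toLeft.1 hx) (Sum.inl y) hxy
  have block₁ : ∀ x ∈ S.toRight, ∀ y, G₁.Adj x y →
      y ∈ T.toRight ∨ s(x, y) ∈ innerPairs .inr D := by
    intro x hx y hxy
    rw [Finset.mem_toRight, mem_innerPairs]
    exact hD (Sum.inr x) (Finset.mem_toRight.1 hx) (Sum.inr y) hxy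
  have cross₀ : S.toLeft.card ≤ T.toRight.card + (crossPairs D).card := by
    refine Finset.card_le_card_add_card_of_injOn (f := φ)
      (g := fun x => s(Sum.inl x, Sum.inr (φ x))) φ.injective.injOn ?_ fun x hx => ?_
    · intro x _ y _ hxy
      simpa using hxy
    · rw [Finset.mem_toRight]
      exact (hD (Sum.inl x) (Finset.mem_toLeft.1 hx) (Sum.inr (φ x)) rfl).imp_right
        fun h => mem_crossPairs.2 ⟨h, _, _, rfl⟩
  have cross₁ : S.toRight.card ≤ T.toLeft.card + (crossPairs D).card := by
    refine Finset.card_le_card_add_card_of_injOn (f := φ.symm)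
      (g := fun x => s(Sum.inr x, Sum.inl (φ.symm x))) φ.symm.injective.injOn ?_ fun x hx => ?_
    · intro x _ y _ hxy
      simpa using hxy
    · rw [Finset.mem_toLeft]
      exact (hD (Sum.inr x) (Finset.mem_toRight.1 hx) (Sum.inl (φ.symm x))
        (φ.apply_symm_apply x)).imp_right
        fun h => mem_crossPairs.2 ⟨h, _, _, Sym2.eq_swap⟩
  have hS_pos := hS.card_pos
  rcases S.toLeft.eq_empty_or_nonempty with hl | ⟨x, hx⟩
  · rw [hl, Finset.card_empty] at hS_card
    have hr : S.toRight.Nonempty := Finset.card_pos.1 (by omega)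
    have := h₁ _ _ _ hr disj₁ block₁
    obtain ⟨x, hx⟩ := hr
    have := hd₁.le_card_add_card (block₁ x hx)
    omega
  · have hl_pos := Finset.card_pos.2 ⟨x, hx⟩
    have := h₀ _ _ _ ⟨x, hx⟩ disj₀ block₀
    have := hd₀.le_card_add_card (block₀ x hx)
    rcases S.toRight.eq_empty_or_nonempty with hr | hr
    · rw [hr, Finset.card_empty] at hS_card
      omega
    · have := h₁ _ _ _ hr disj₁ block₁
      omega

/-! ### Restricted HL-graphs -/

theorem IsRestrictedHL.three_le {m : ℕ} {V : Type*} {G : SimpleGraph V}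
    (h : IsRestrictedHL m G) : 3 ≤ m := by
  induction h with
  | base e => exact le_rfl
  | step _ _ _ _ ih _ => exact ih.trans (Nat.le_succ _)

theorem IsRestrictedHL.nonempty {m : ℕ} {V : Type*} {G : SimpleGraph V}
    (h : IsRestrictedHL m G) : Nonempty V := by
  induction h with
  | base e => exact ⟨e.symm 0⟩
  | step _ _ φ e ih _ => exact ih.map fun x => e.symm (Sum.inl x)

theorem IsRestrictedHL.hasDegree {m : ℕ} {V : Type*} {G : SimpleGraph V}
    (h : IsRestrictedHL m G) : HasDegree G m := by
  induction h with
  | base e => exact hasDegree_recursiveCirculant84.of_iso e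
  | step _ _ φ e ih₀ ih₁ => exact (ih₀.matchingJoin ih₁ φ).of_iso e

theorem IsRestrictedHL.expands {m : ℕ} {V : Type*} {G : SimpleGraph V}
    (h : IsRestrictedHL m G) : Expands G (min (2 ^ (m - 3)) (m - 1)) := by
  induction h with
  | base e => exact expands_recursiveCirculant84.of_iso e
  | @step m _ _ _ _ _ _ h₀ h₁ φ e ih₀ ih₁ =>
    refine ((ih₀.matchingJoin ih₁ h₀.hasDegree h₁.hasDegree φ).of_iso e).mono ?_
    obtain ⟨n, rfl⟩ := Nat.exists_eq_add_of_le' h₀.three_le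
    have hn : n < 2 ^ n := Nat.lt_two_pow_self
    rw [show n + 3 + 1 - 3 = n + 1 by omega, show n + 3 - 3 = n by omega, pow_succ]
    omega

/-! ### Fractional perfect matchings from Hall's theorem -/

/-- For a permutation `σ` moving every vertex to a neighbour, each `v` contributes weight `1/2` to
the edge `{v, σ v}`. The weight at `v` comes from `v` itself and from `σ⁻¹ v`. -/
theorem exists_isFractionalPerfectMatching_of_injective {V : Type*} [Fintype V]
    {G : SimpleGraph V} {σ : V → V} (hσ : Function.Injective σ) (hadj : ∀ v, G.Adj v (σ v)) :
    ∃ f : G.edgeSet → ℝ, IsFractionalPerfectMatching G f := by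
  classical
  let f : G.edgeSet → ℝ := fun e => ∑ u : V, if s(u, σ u) = e.val then 1 / 2 else 0
  have hf_nonneg : ∀ e, 0 ≤ f e := fun e => Finset.sum_nonneg fun u _ => by split_ifs <;> norm_num
  have hf_sum : ∀ v : V, ∑ e : G.edgeSet with v ∈ e.val, f e = 1 := by
    intro v
    obtain ⟨w, hw⟩ := (Finite.injective_iff_surjective.1 hσ) v
    have hwv : w ≠ v := by
      rintro rfl
      exact (hadj w).ne hw.symm
    have key : ∀ u : V, (∑ e : G.edgeSet with v ∈ e.val,
        if s(u, σ u) = e.val then (1 / 2 : ℝ) else 0) =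
        (if u = v then 1 / 2 else 0) + if u = w then 1 / 2 else 0 := by
      intro u
      have hu : ∀ e : G.edgeSet, s(u, σ u) = e.val ↔ (⟨s(u, σ u), hadj u⟩ : G.edgeSet) = e :=
        fun e => by rw [Subtype.ext_iff]
      have hσu : v = σ u ↔ u = w := by rw [← hw, hσ.eq_iff, eq_comm]
      simp only [hu, Finset.sum_ite_eq, Finset.mem_filter, Finset.mem_univ, true_and,
        Sym2.mem_iff, hσu]
      by_cases h1 : u = v
      · subst h1
        simp [hwv.symm]
      · simp [h1, Ne.symm h1]
    simp only [f]
    rw [Finset.sum_comm, Finset.sum_congr rfl fun u _ => key u, Finset.sum_add_distrib]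
    norm_num
  refine ⟨f, fun e => ⟨hf_nonneg e, ?_⟩, fun v => ?_⟩
  · obtain ⟨⟨a, b⟩, he⟩ := e.val.exists_rep
    have ha : a ∈ e.val := he ▸ Sym2.mem_mk_left a b
    rw [← hf_sum a]
    exact Finset.single_le_sum (f := f) (fun e _ => hf_nonneg e) (by simpa using ha)
  · convert hf_sum v

/-- Hall's condition survives the removal of at most `k` vertices and edges; here
`N` contains all remaining neighbours of `S`. The vertices in `S ∩ N` count on both sides, so
only `S \ N` and `N \ S` matter. No remaining edge joins `S \ N` to `S`, so each edge of `G` at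
`S \ N` ends in a removed vertex or in `N \ S`, or has itself been removed. -/
theorem Expands.card_le_card_neighbors {V : Type*} {G : SimpleGraph V} {k : ℕ} (h : Expands G k)
    {FV : Finset V} {FE : Finset (Sym2 V)} (hF : FV.card + FE.card ≤ k)
    (S N : Finset {v : V // v ∉ FV}) (hN : ∀ x ∈ S, ∀ y, (deleteFaults G FV FE).Adj x y → y ∈ N) :
    S.card ≤ N.card := by
  classical
  have hS_card := Finset.card_sdiff_add_card_inter S N
  have hN_card := Finset.card_sdiff_add_card_inter N S
  rw [Finset.inter_comm N S] at hN_card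
  rcases (S \ N).eq_empty_or_nonempty with hS | hS
  · rw [hS, Finset.card_empty] at hS_card
    omega
  let ι : {v : V // v ∉ FV} ↪ V := Function.Embedding.subtype _
  have key := h ((S \ N).map ι) (FV ∪ (N \ S).map ι) FE (by simpa using hS) ?_ ?_
  · have hle := Finset.card_union_le FV ((N \ S).map ι)
    simp only [Finset.card_map] at key hle
    omega
  · rw [Finset.disjoint_union_right, Finset.disjoint_map]
    refine ⟨Finset.disjoint_left.2 fun x hx => ?_, Finset.disjoint_left.2 fun x hx hx' => ?_⟩
    · obtain ⟨x, -, rfl⟩ := Finset.mem_map.1 hx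
      exact x.2
    · exact (Finset.mem_sdiff.1 hx').2 (Finset.mem_sdiff.1 hx).1
  · intro x hx y hxy
    obtain ⟨x, hxSN, rfl⟩ := Finset.mem_map.1 hx
    obtain ⟨hxS, hxN⟩ := Finset.mem_sdiff.1 hxSN
    by_cases hy : y ∈ FV
    · exact Or.inl (Finset.mem_union_left _ hy)
    by_cases hxyF : s(x.val, y) ∈ FE
    · exact Or.inr hxyF
    have hadj : (deleteFaults G FV FE).Adj x ⟨y, hy⟩ := by
      rw [deleteFaults, SimpleGraph.comap_adj, SimpleGraph.deleteEdges_adj]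
      exact ⟨hxy, hxyF⟩
    have hyS : (⟨y, hy⟩ : {v : V // v ∉ FV}) ∉ S := fun hyS => hxN (hN _ hyS _ hadj.symm)
    exact Or.inl (Finset.mem_union_right _ (Finset.mem_map.2
      ⟨⟨y, hy⟩, Finset.mem_sdiff.2 ⟨hN _ hxS _ hadj, hyS⟩, rfl⟩))

theorem Expands.lt_of_isFSMPSet {V : Type*} [Fintype V] {G : SimpleGraph V} {k : ℕ}
    (h : Expands G k) {FV : Finset V} {FE : Finset (Sym2 V)} (hF : IsFSMPSet G FV FE) :
    k < FV.card + FE.card := by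
  classical
  by_contra! hle
  apply hF.2
  let t : {v : V // v ∉ FV} → Finset {v : V // v ∉ FV} := fun x =>
    Finset.univ.filter fun y => (deleteFaults G FV FE).Adj x y
  have hall : ∀ S : Finset {v : V // v ∉ FV}, S.card ≤ (S.biUnion t).card := fun S =>
    h.card_le_card_neighbors hle S _
      fun x hx y hxy => Finset.mem_biUnion.2 ⟨x, hx, by simpa [t] using hxy⟩
  obtain ⟨σ, hσ, hσt⟩ := (Finset.all_card_le_biUnion_card_iff_exists_injective t).1 hall
  obtain ⟨f, hf⟩ := exists_isFractionalPerfectMatching_of_injective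
    (G := deleteFaults G FV FE) hσ fun v => by simpa [t] using hσt v
  refine ⟨f, ?_⟩
  convert hf

theorem HasDegree.exists_isFSMPSet {V : Type*} [Fintype V] {G : SimpleGraph V} {d : ℕ}
    (h : HasDegree G d) (v : V) :
    ∃ (FV : Finset V) (FE : Finset (Sym2 V)), IsFSMPSet G FV FE ∧ FV.card + FE.card = d := by
  classical
  obtain ⟨N, rfl, hN⟩ := h v
  refine ⟨∅, N.image fun y => s(v, y), ⟨?_, ?_⟩, ?_⟩
  · intro e he
    obtain ⟨y, hy, rfl⟩ := Finset.mem_image.1 (Finset.mem_coe.1 he)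
    exact (hN y).1 hy
  · rintro ⟨f, -, hf⟩
    -- The vertex `v` has become isolated, so the sum of the weights at `v` is empty.
    refine zero_ne_one (α := ℝ) ((Finset.sum_eq_zero ?_).symm.trans (hf ⟨v, by simp⟩))
    rintro ⟨e, he⟩ hve
    obtain ⟨w, rfl⟩ := Sym2.mem_iff_exists.1 (by simpa using hve)
    rw [SimpleGraph.mem_edgeSet, deleteFaults, SimpleGraph.comap_adj,
      SimpleGraph.deleteEdges_adj] at he
    exact absurd (Finset.mem_coe.2 (Finset.mem_image_of_mem _ ((hN _).2 he.1))) he.2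
  · rw [Finset.card_image_of_injective _ fun y z hyz => Sym2.congr_right.1 hyz]
    simp

theorem mainTheorem5 {V : Type*} [Fintype V] (G : SimpleGraph V) (hG : IsRestrictedHL 5 G) :
    fsmp G = 5 := by
  obtain ⟨v⟩ := hG.nonempty
  have hmem := hG.hasDegree.exists_isFSMPSet v
  refine le_antisymm (Nat.sInf_le hmem) (le_csInf ⟨5, hmem⟩ ?_)
  rintro _ ⟨FV, FE, hF, rfl⟩
  exact hG.expands.lt_of_isFSMPSet hF
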